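/- For $n\times n$ complex matrices write $\Re(A)=\frac{A+A^*}{2}$ and $W(A)=\{\langle Ax,x\rangle : \|x\|=1\}$ (the numerical range). A matrix is accretive if its numerical range lies in $\{z\in\mathbb C:\Re z\ge 0\}$, and strictly accretive if $\Re(A)$ is positive definite. A $2\times 2$ block matrix $\begin{bmatrix}A&X\\Y^*&B\end{bmatrix}$ with $n\times n$ blocks is APT (accretive partial transpose) if both it and its partial transpose $\begin{bmatrix}A&Y^*\\X&B\end{bmatrix}$ are accretive. For $\alpha\in[0,\pi/2)$ let $S_\alpha=\{z\in\mathbb C:\Re z\ge 0,\ |\Im z|\le \tan(\alpha)\,\Re z\}$. For strictly accretive $A,B$ and $t\in[0,1]$ let $$A\sharp_tB=A^{1/2}\left(A^{-1/2}BA^{-1/2}\right)^tA^{1/2},$$ where powers are taken by the holomorphic functional calculus with the principal branch of $z\mapsto z^r$ on $\mathbb C\setminus(-\infty,0]$. Let $A,B$ be strictly accretive $n\times n$ complex matrices and let $X$ be an $n\times n$ complex matrix such that $M=\begin{bmatrix}A&X\\X^*&B\end{bmatrix}$ is APT and $W(M)\subseteq S_\alpha$ for some $\alpha\in[0,\pi/2)$.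 Then for every $t\in[0,1]$ and every unitarily invariant norm $\|\cdot\|_u$ on the $n\times n$ complex matrices, $$\|X\|_u\le\frac{\sec(\alpha)}{2}\,\bigl\|A\sharp_tB+A\sharp_{1-t}B\bigr\|_u .$$ -/

import Mathlib

open scoped Matrix Polynomial ComplexOrder

namespace AccretiveMatrix

/-- The numerical range `W(A)`, the set of all `⟨A x, x⟩ = x* A x` with `‖x‖ = 1`. -/
def numericalRange {m : Type*} [Fintype m] (A : Matrix m m ℂ) : Set ℂ :=
  {z | ∃ x : EuclideanSpace ℂ m, ‖x‖ = 1 ∧ z = star x.ofLp ⬝ᵥ (A *ᵥ x.ofLp)}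

/-- The closed sector `S_α` in the right half plane with half angle `α`. -/
def sector (α : ℝ) : Set ℂ :=
  {z | 0 ≤ z.re ∧ |z.im| ≤ Real.tan α * z.re}

/-- Accretive matrices: the numerical range lies in the closed right half plane. -/
def IsAccretive {m : Type*} [Fintype m] (A : Matrix m m ℂ) : Prop :=
  numericalRange A ⊆ {z | 0 ≤ z.re}

/-- The real part `(A + A*) / 2` of a matrix. -/
noncomputable def rePart {m : Type*} (A : Matrix m m ℂ) : Matrix m m ℂ :=
  (1 / 2 : ℂ) • (A + Aᴴ)

/-- Strictly accretive matrices: the real part is positive definite. -/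
def IsStrictlyAccretive {m : Type*} (A : Matrix m m ℂ) : Prop :=
  (rePart A).PosDef

/-- The partial transpose of a `2 × 2` block matrix: the off-diagonal blocks are exchanged. -/
def partialTranspose {m : Type*} (M : Matrix (m ⊕ m) (m ⊕ m) ℂ) : Matrix (m ⊕ m) (m ⊕ m) ℂ :=
  Matrix.fromBlocks M.toBlocks₁₁ M.toBlocks₂₁ M.toBlocks₁₂ M.toBlocks₂₂

/-- Accretive partial transpose (APT): the block matrix and its partial transpose are accretive. -/
def IsAPT {m : Type*} [Fintype m] (M : Matrix (m ⊕ m) (m ⊕ m) ℂ) : Prop :=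
  IsAccretive M ∧ IsAccretive (partialTranspose M)

/-- A unitarily invariant norm on the `m × m` complex matrices: a definite seminorm that does not
change under multiplication by unitary matrices from the left and from the right. -/
def IsUnitarilyInvariantNorm {m : Type*} [Fintype m] [DecidableEq m]
    (N : Seminorm ℂ (Matrix m m ℂ)) : Prop :=
  (∀ A, N A = 0 → A = 0) ∧
    ∀ A : Matrix m m ℂ, ∀ U ∈ Matrix.unitaryGroup m ℂ, ∀ V ∈ Matrix.unitaryGroup m ℂ,
      N (U * A * V) = N A

/-- `p` is a Hermite interpolation polynomial of `f` on the spectrum of `A`: at every eigenvalue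
`μ` of `A` the derivatives of `p` and of `f` agree up to the order given by the algebraic
multiplicity of `μ`. (At a point that is no eigenvalue the condition is empty.) -/
def IsInterpolant {m : Type*} [Fintype m] [DecidableEq m]
    (f : ℂ → ℂ) (A : Matrix m m ℂ) (p : ℂ[X]) : Prop :=
  ∀ μ : ℂ, ∀ k < A.charpoly.rootMultiplicity μ,
    (Polynomial.derivative^[k] p).eval μ = iteratedDeriv k f μ

theorem exists_isInterpolant {m : Type*} [Fintype m] [DecidableEq m]
    (f : ℂ → ℂ) (A : Matrix m m ℂ) : ∃ p : ℂ[X], IsInterpolant f A p := by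
  classical
  have key : ∀ (p : ℂ[X]) (μ : ℂ) (k : ℕ), (Polynomial.derivative^[k] p).eval μ =
      (k.factorial : ℂ) * (Polynomial.taylor μ p).coeff k := by
    intro p μ k
    rw [Polynomial.taylor_coeff, ← Polynomial.factorial_smul_hasseDeriv]
    simp
  let r : ℂ → ℕ := fun μ => A.charpoly.rootMultiplicity μ
  let T : ℂ → ℂ[X] := fun μ => Polynomial.taylor (-μ)
    (∑ k ∈ Finset.range (r μ), Polynomial.C (iteratedDeriv k f μ / k.factorial) * Polynomial.X ^ k)
  let ι := {μ : ℂ // μ ∈ A.charpoly.roots.toFinset}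
  have hI : Pairwise (Function.onFun IsCoprime fun i : ι =>
      Ideal.span {(Polynomial.X - Polynomial.C i.1) ^ r i.1}) := by
    intro i j hij
    refine (Ideal.isCoprime_span_singleton_iff _ _).2 ?_
    exact (Polynomial.pairwise_coprime_X_sub_C (s := fun i : ι => i.1)
      Subtype.val_injective hij).pow
  obtain ⟨p, hp⟩ := Ideal.exists_forall_sub_mem_ideal hI (fun i => T i.1)
  refine ⟨p, fun μ k hk => ?_⟩
  have hμ : μ ∈ A.charpoly.roots.toFinset := by
    rw [Multiset.mem_toFinset, ← Multiset.count_pos, Polynomial.count_roots]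
    exact Nat.zero_lt_of_lt hk
  obtain ⟨q, hq⟩ := Ideal.mem_span_singleton.1 (hp ⟨μ, hμ⟩)
  have hpe : p = T μ + (Polynomial.X - Polynomial.C μ) ^ r μ * q := by
    rw [← hq]; ring
  have hk' : k < r μ := hk
  have hX : Polynomial.taylor μ (Polynomial.X - Polynomial.C μ) = Polynomial.X := by simp
  have hT : Polynomial.taylor μ p = (∑ k ∈ Finset.range (r μ),
      Polynomial.C (iteratedDeriv k f μ / k.factorial) * Polynomial.X ^ k) +
      Polynomial.X ^ r μ * Polynomial.taylor μ q := by
    rw [hpe, map_add, Polynomial.taylor_mul, Polynomial.taylor_pow, hX]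
    simp only [T]
    rw [Polynomial.taylor_taylor, add_neg_cancel, Polynomial.taylor_zero]
  rw [key, hT, Polynomial.coeff_add, Polynomial.coeff_X_pow_mul', if_neg (by omega),
    Polynomial.finsetSum_coeff]
  simp only [Polynomial.coeff_C_mul_X_pow]
  rw [Finset.sum_ite_eq, if_pos (Finset.mem_range.2 hk'), add_zero]
  exact mul_div_cancel₀ _ (by exact_mod_cast k.factorial_ne_zero)

/-- The value at `A` does not depend on the choice of the interpolation polynomial. -/
theorem IsInterpolant.aeval_eq {m : Type*} [Fintype m] [DecidableEq m]
    {f : ℂ → ℂ} {A : Matrix m m ℂ} {p q : ℂ[X]} (hp : IsInterpolant f A p)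
    (hq : IsInterpolant f A q) : Polynomial.aeval A p = Polynomial.aeval A q := by
  classical
  have h0 : A.charpoly ≠ 0 := A.charpoly_monic.ne_zero
  have hdvd : A.charpoly ∣ p - q := by
    by_cases hpq : p - q = 0
    · rw [hpq]; exact dvd_zero _
    rw [IsAlgClosed.dvd_iff_roots_le_roots h0 hpq, Multiset.le_iff_count]
    intro μ
    rw [Polynomial.count_roots, Polynomial.count_roots]
    by_contra! hlt
    refine lt_irrefl ((p - q).rootMultiplicity μ) ((Polynomial.lt_rootMultiplicity_iff_isRoot_iterate_derivative hpq).2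
      fun k hk => ?_)
    rw [Polynomial.IsRoot, Polynomial.iterate_derivative_sub, Polynomial.eval_sub,
      hp μ k (hk.trans_lt hlt), hq μ k (hk.trans_lt hlt), sub_self]
  obtain ⟨c, hc⟩ := hdvd
  rw [← sub_eq_zero, ← map_sub, hc, map_mul, Matrix.aeval_self_charpoly, zero_mul]

/-- The matrix function `f(A)` (holomorphic functional calculus) for `f` holomorphic in a
neighbourhood of the spectrum of `A`: the value at `A` of any Hermite interpolation polynomial
of `f` on the spectrum of `A`. -/
noncomputable def matFun {m : Type*} [Fintype m] [DecidableEq m]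
    (f : ℂ → ℂ) (A : Matrix m m ℂ) : Matrix m m ℂ :=
  Polynomial.aeval A (exists_isInterpolant f A).choose

theorem matFun_eq {m : Type*} [Fintype m] [DecidableEq m]
    {f : ℂ → ℂ} {A : Matrix m m ℂ} {p : ℂ[X]} (hp : IsInterpolant f A p) :
    matFun f A = Polynomial.aeval A p :=
  (exists_isInterpolant f A).choose_spec.aeval_eq hp

/-- The principal power `A ^ r`, for matrices without eigenvalues in `(-∞, 0]`; the function
`z ↦ z ^ r` is the principal branch, holomorphic off `(-∞, 0]`. -/
noncomputable def matPow {m : Type*} [Fintype m] [DecidableEq m]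
    (A : Matrix m m ℂ) (r : ℝ) : Matrix m m ℂ :=
  matFun (fun z => z ^ (r : ℂ)) A

/-- The weighted geometric mean `A ♯_t B = A^(1/2) (A^(-1/2) B A^(-1/2))^t A^(1/2)`. -/
noncomputable def geomMean {m : Type*} [Fintype m] [DecidableEq m]
    (t : ℝ) (A B : Matrix m m ℂ) : Matrix m m ℂ :=
  matPow A (1 / 2) * matPow (matPow A (-(1 / 2)) * B * matPow A (-(1 / 2))) t * matPow A (1 / 2)

end AccretiveMatrix

/-! The bound already holds with the constant `1 / 2`; the secant enters only through `1 ≤ 1 /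
Real.cos α`. Order statements below refer to real parts of quadratic forms.

The core is that the APT property passes to geometric means: the block matrix with diagonal `A ♯_t
B`, `A ♯_(1-t) B` and off-diagonal `X`, `Xᴴ` is accretive (`IsAPT.geomMean_block_nonneg`).
Diagonalize simultaneously Re A = S*S and Re B = S*DS, and write X = Z*S. Minimizing the two
accretivity conditions over the second vector gives Re A ≥ Z*D⁻¹Z and Re B ≥ Z*Z. Such lower bounds,
diagonal in common coordinates, pass to geometric means (`sum_le_re_geomMean`), so A ♯_t B dominates
Z*D^(t-1)Z and A ♯_(1-t) B dominates S*D^(1-t)S. The weighted arithmetic-geometric mean inequality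
in each coordinate then absorbs the cross term.

The passage to geometric means rests on z^t = c ∫ s^t (s⁻¹ - (s + z)⁻¹) ds. For each s the integrand
turns A and B into a parallel sum, whose form splits as s⁻¹ u*Au + w*Bw with x = u + s w
(`exists_form_eq`). The bounds apply to u and w separately, and the scalar inequality
`parallel_sum_le` recombines them.

Adding the statements for t and 1 - t makes both diagonal blocks equal to the symmetric sum. Testing
this on singular vectors of X bounds its singular values by diagonal entries of an average of
unitary conjugates of the sum; pinching and monotonicity on diagonal matrices finish
(`le_half_of_block_nonneg`). -/

namespace AccretiveMatrix

/-! ### Calculus of matrix functions defined by Hermite interpolation. -/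

section MatrixFunctions

variable {m : Type*} [Fintype m] [DecidableEq m]

theorem iteratedDeriv_polynomial_eval (p : ℂ[X]) (k : ℕ) :
    iteratedDeriv k (fun z => p.eval z) = fun z => (Polynomial.derivative^[k] p).eval z := by
  induction k with
  | zero => simp
  | succ k ih =>
    rw [iteratedDeriv_succ, ih]
    funext z
    rw [Polynomial.deriv, Function.iterate_succ_apply']

theorem isInterpolant_polynomial (p : ℂ[X]) (A : Matrix m m ℂ) :
    IsInterpolant (fun z => p.eval z) A p := fun μ k _ => by
  rw [iteratedDeriv_polynomial_eval]

theorem isRoot_of_lt_rootMultiplicity {A : Matrix m m ℂ} {μ : ℂ} {k : ℕ}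
    (hk : k < A.charpoly.rootMultiplicity μ) : A.charpoly.IsRoot μ :=
  (Polynomial.rootMultiplicity_pos A.charpoly_monic.ne_zero).1 (Nat.zero_lt_of_lt hk)

/-- The Leibniz rule expresses each jet of the product by jets of the factors of no higher order,
which are already matched. -/
theorem IsInterpolant.mul {f g : ℂ → ℂ} {A : Matrix m m ℂ} {p q : ℂ[X]}
    (hp : IsInterpolant f A p) (hq : IsInterpolant g A q)
    (hf : ∀ μ, A.charpoly.IsRoot μ → AnalyticAt ℂ f μ)
    (hg : ∀ μ, A.charpoly.IsRoot μ → AnalyticAt ℂ g μ) :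
    IsInterpolant (f * g) A (p * q) := by
  intro μ k hk
  have hr := isRoot_of_lt_rootMultiplicity hk
  have h1 := congrFun (iteratedDeriv_polynomial_eval (p * q) k) μ
  have h2 : (fun z => (p * q).eval z) = (fun z => p.eval z) * (fun z => q.eval z) := by
    funext z; simp
  rw [← h1, h2, iteratedDeriv_mul p.differentiable.contDiff.contDiffAt
      q.differentiable.contDiff.contDiffAt,
    iteratedDeriv_mul (hf μ hr).contDiffAt (hg μ hr).contDiffAt]
  refine Finset.sum_congr rfl fun i hi => ?_
  have hi' : i ≤ k := Nat.lt_succ_iff.1 (Finset.mem_range.1 hi)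
  rw [iteratedDeriv_polynomial_eval, iteratedDeriv_polynomial_eval, ← hp μ i (hi'.trans_lt hk),
    ← hq μ (k - i) ((Nat.sub_le k i).trans_lt hk)]

theorem IsInterpolant.congr {f g : ℂ → ℂ} {A : Matrix m m ℂ} {p : ℂ[X]}
    (hp : IsInterpolant f A p) (hfg : ∀ μ, A.charpoly.IsRoot μ → f =ᶠ[nhds μ] g) :
    IsInterpolant g A p := fun μ k hk => by
  rw [hp μ k hk, (hfg μ (isRoot_of_lt_rootMultiplicity hk)).iteratedDeriv_eq]

theorem matFun_mul {f g : ℂ → ℂ} {A : Matrix m m ℂ}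
    (hf : ∀ μ, A.charpoly.IsRoot μ → AnalyticAt ℂ f μ)
    (hg : ∀ μ, A.charpoly.IsRoot μ → AnalyticAt ℂ g μ) :
    matFun f A * matFun g A = matFun (f * g) A := by
  obtain ⟨p, hp⟩ := exists_isInterpolant f A
  obtain ⟨q, hq⟩ := exists_isInterpolant g A
  rw [matFun_eq hp, matFun_eq hq, matFun_eq (hp.mul hq hf hg), map_mul]

theorem matFun_congr {f g : ℂ → ℂ} {A : Matrix m m ℂ}
    (hfg : ∀ μ, A.charpoly.IsRoot μ → f =ᶠ[nhds μ] g) : matFun f A = matFun g A := by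
  obtain ⟨p, hp⟩ := exists_isInterpolant f A
  rw [matFun_eq hp, matFun_eq (hp.congr hfg)]

theorem matFun_polynomial (p : ℂ[X]) (A : Matrix m m ℂ) :
    matFun (fun z => p.eval z) A = Polynomial.aeval A p :=
  matFun_eq (isInterpolant_polynomial p A)

theorem matFun_id (A : Matrix m m ℂ) : matFun (fun z => z) A = A := by
  simpa using matFun_polynomial Polynomial.X A

theorem matFun_const (c : ℂ) (A : Matrix m m ℂ) :
    matFun (fun _ => c) A = c • (1 : Matrix m m ℂ) := by
  simpa [Algebra.algebraMap_eq_smul_one] using matFun_polynomial (Polynomial.C c) A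

/-- Every linear functional of `f(A)` is a fixed finite linear combination of the derivatives of `f`
at the eigenvalues of `A`. -/
theorem exists_matFun_eq_sum (A : Matrix m m ℂ) (φ : Matrix m m ℂ →ₗ[ℂ] ℂ) :
    ∃ (ι : Type) (_ : Fintype ι) (μ : ι → ℂ) (k : ι → ℕ) (a : ι → ℂ),
      (∀ i, A.charpoly.IsRoot (μ i)) ∧
        ∀ f : ℂ → ℂ, φ (matFun f A) = ∑ i, a i * iteratedDeriv (k i) f (μ i) := by
  classical
  let ι := (μ : {μ : ℂ // μ ∈ A.charpoly.roots.toFinset}) × Fin (A.charpoly.rootMultiplicity μ.1)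
  let J : ι → ℂ[X] →ₗ[ℂ] ℂ := fun i =>
    (Polynomial.leval i.1.1).comp (Polynomial.derivative ^ (i.2 : ℕ))
  have hJ : ∀ i p, J i p = (Polynomial.derivative^[i.2] p).eval i.1.1 := fun i p => by
    simp [J, Module.End.pow_apply, Polynomial.leval]
  -- A polynomial whose listed jets all vanish interpolates 0, hence vanishes at `A`. So `p ↦ φ
  -- (p(A))` lies in the span of the finitely many jet functionals.
  have hker : ⨅ i, LinearMap.ker (J i) ≤
      LinearMap.ker (φ.comp (Polynomial.aeval A).toLinearMap) := by
    intro p hp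
    simp only [Submodule.mem_iInf, LinearMap.mem_ker, hJ] at hp
    have h0 : IsInterpolant (fun _ => (0 : ℂ)) A p := by
      intro μ k hk
      have hμ : μ ∈ A.charpoly.roots.toFinset := by
        simpa [A.charpoly_monic.ne_zero] using isRoot_of_lt_rootMultiplicity hk
      have := hp ⟨⟨μ, hμ⟩, ⟨k, hk⟩⟩
      simp only at this
      rw [this]
      simp
    have := h0.aeval_eq (q := 0) (by simpa using isInterpolant_polynomial 0 A)
    simp [this]
  obtain ⟨a, ha⟩ := (Submodule.mem_span_range_iff_exists_fun ℂ).1 (mem_span_of_iInf_ker_le_ker hker)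
  refine ⟨ι, inferInstance, fun i => i.1.1, fun i => i.2, a, fun i => ?_, fun f => ?_⟩
  · have := i.1.2
    rw [Multiset.mem_toFinset] at this
    exact (Polynomial.mem_roots'.1 this).2
  · obtain ⟨p, hp⟩ := exists_isInterpolant f A
    have h := LinearMap.congr_fun ha p
    rw [matFun_eq hp]
    simp only [LinearMap.coe_comp, Function.comp_apply, AlgHom.toLinearMap_apply] at h
    rw [← h]
    simp only [LinearMap.sum_apply, LinearMap.smul_apply, hJ, smul_eq_mul]
    exact Finset.sum_congr rfl fun i _ => by rw [hp _ _ i.2.2]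

end MatrixFunctions

/-! ### Integral representation of the principal power and of its derivatives. -/

section PowerIntegral

open MeasureTheory Set

/-- The `k`-th derivative with respect to `z` of `s⁻¹ - (s + z)⁻¹`. -/
noncomputable def resolventDeriv (k : ℕ) (s : ℝ) (z : ℂ) : ℂ :=
  (if k = 0 then (s : ℂ)⁻¹ else 0) - (-1) ^ k * k.factorial * ((s + z) ^ (k + 1))⁻¹

theorem ofReal_add_mem_slitPlane {z : ℂ} (hz : z ∈ Complex.slitPlane) {s : ℝ} (hs : 0 ≤ s) :
    (s : ℂ) + z ∈ Complex.slitPlane := by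
  rw [Complex.mem_slitPlane_iff] at hz ⊢
  rcases hz with h | h
  · left; simp; linarith
  · right; simpa using h

theorem hasDerivAt_resolventDeriv (k : ℕ) {s : ℝ} (hs : 0 ≤ s) {z : ℂ}
    (hz : z ∈ Complex.slitPlane) :
    HasDerivAt (resolventDeriv k s) (resolventDeriv (k + 1) s z) z := by
  have hne : (s : ℂ) + z ≠ 0 := Complex.slitPlane_ne_zero (ofReal_add_mem_slitPlane hz hs)
  have h1 : HasDerivAt (fun z : ℂ => (s : ℂ) + z) 1 z := (hasDerivAt_id z).const_add _
  have h2 := ((h1.fun_pow (k + 1)).fun_inv (pow_ne_zero _ hne)).const_mul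
    ((-1) ^ k * (k.factorial : ℂ))
  have h3 := h2.const_sub (if k = 0 then (s : ℂ)⁻¹ else 0)
  refine HasDerivAt.congr_deriv (f := resolventDeriv k s) h3 ?_
  rw [resolventDeriv, if_neg (Nat.succ_ne_zero k), Nat.factorial_succ]
  push_cast
  field_simp
  ring

theorem iteratedDeriv_eq_of_hasDerivAt {U : Set ℂ} (hU : IsOpen U) {F : ℕ → ℂ → ℂ}
    (hF : ∀ k, ∀ z ∈ U, HasDerivAt (F k) (F (k + 1) z) z) (k : ℕ) :
    ∀ z ∈ U, iteratedDeriv k (F 0) z = F k z := by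
  induction k with
  | zero => intro z _; rw [iteratedDeriv_zero]
  | succ k ih =>
    intro z hz
    rw [iteratedDeriv_succ, ← (hF k z hz).deriv]
    exact Filter.EventuallyEq.deriv_eq (Filter.eventuallyEq_of_mem (hU.mem_nhds hz) ih)

/-- Small `s` is controlled by the distance from `z₀` to the cut, large `s` by the triangle
inequality. Linear growth in `s`, uniform near `z₀`, is what domination of the resolvent derivatives
requires. -/
theorem exists_lower_bound_norm_add {z₀ : ℂ} (hz₀ : z₀ ∈ Complex.slitPlane) :
    ∃ δ > 0, ∃ c > 0, Metric.ball z₀ δ ⊆ Complex.slitPlane ∧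
      ∀ z ∈ Metric.ball z₀ δ, ∀ s : ℝ, 0 ≤ s → c * (1 + s) ≤ ‖(s : ℂ) + z‖ := by
  obtain ⟨d, hd, hball⟩ := Metric.isOpen_iff.1 Complex.isOpen_slitPlane z₀ hz₀
  set R := ‖z₀‖ + d with hR
  have hRpos : 0 < R := by positivity
  -- The first term of the minimum serves `s ≤ 2R`, the second serves `s > 2R`.
  refine ⟨d / 2, half_pos hd, min (d / 2 / (1 + 2 * R)) (1 / (2 * (1 + 2 * R)) * min 1 (2 * R)),
    by positivity, (Metric.ball_subset_ball (by linarith)).trans hball, fun z hz s hs => ?_⟩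
  have hz' : ‖z - z₀‖ < d / 2 := by simpa [dist_eq_norm] using hz
  rcases le_or_gt s (2 * R) with hsR | hsR
  · have h1 : d / 2 ≤ ‖(s : ℂ) + z‖ := by
      by_contra! hlt
      have : (-s : ℂ) ∈ Metric.ball z₀ d := by
        rw [Metric.mem_ball, dist_eq_norm]
        calc ‖(-s : ℂ) - z₀‖ = ‖(z - z₀) - (s + z)‖ := by congr 1; ring
          _ ≤ ‖z - z₀‖ + ‖(s : ℂ) + z‖ := norm_sub_le _ _
          _ < d := by linarith
      have := hball this
      rw [Complex.mem_slitPlane_iff] at this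
      simp at this
      linarith
    refine le_trans ?_ h1
    calc _ ≤ d / 2 / (1 + 2 * R) * (1 + 2 * R) := by
          gcongr
          exact min_le_left _ _
      _ = d / 2 := by field_simp
  · have h1 : s - R ≤ ‖(s : ℂ) + z‖ := by
      have h2 : ‖z‖ ≤ R := by
        have := norm_add_le (z - z₀) z₀
        rw [sub_add_cancel] at this
        linarith
      have h3 := norm_sub_le ((s : ℂ) + z) z
      rw [add_sub_cancel_right, Complex.norm_real, Real.norm_of_nonneg hs] at h3
      linarith
    refine le_trans ?_ h1
    have h4 : (1 / (2 * (1 + 2 * R)) * min 1 (2 * R)) ≤ R / (1 + 2 * R) := by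
      calc _ ≤ 1 / (2 * (1 + 2 * R)) * (2 * R) := by gcongr; exact min_le_right _ _
        _ = R / (1 + 2 * R) := by field_simp
    calc _ ≤ R / (1 + 2 * R) * (1 + s) := by
          gcongr
          exact (min_le_right _ _).trans h4
      _ ≤ s - R := by
          rw [div_mul_eq_mul_div, div_le_iff₀ (by positivity)]
          nlinarith

/-- After multiplication by `s ^ t` the bound is a multiple of the integrand for `z = 1`, whose
integrability is known. It is therefore the dominating function for every derivative at once. -/
theorem exists_bound_resolventDeriv {z₀ : ℂ} (hz₀ : z₀ ∈ Complex.slitPlane) (k : ℕ) :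
    ∃ δ > 0, ∃ K : ℝ, Metric.ball z₀ δ ⊆ Complex.slitPlane ∧
      ∀ z ∈ Metric.ball z₀ δ, ∀ s : ℝ, 0 < s →
        ‖resolventDeriv k s z‖ ≤ K * (s⁻¹ - (s + 1)⁻¹) := by
  obtain ⟨δ, hδ, c, hc, hsub, hlow⟩ := exists_lower_bound_norm_add hz₀
  refine ⟨δ, hδ, if k = 0 then (‖z₀‖ + δ) / c else k.factorial / c ^ (k + 1), hsub,
    fun z hz s hs => ?_⟩
  have hl := hlow z hz s hs.le
  have hpos : 0 < c * (1 + s) := by positivity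
  have hne : (s : ℂ) + z ≠ 0 := norm_pos_iff.1 (hpos.trans_le hl)
  have hs0 : (s : ℂ) ≠ 0 := by exact_mod_cast hs.ne'
  have hdiff : s⁻¹ - (s + 1)⁻¹ = 1 / (s * (1 + s)) := by field_simp; ring
  rw [hdiff]
  by_cases hk : k = 0
  · subst hk
    have hzn : ‖z‖ ≤ ‖z₀‖ + δ := by
      have := norm_add_le (z - z₀) z₀
      rw [sub_add_cancel] at this
      have hz' : ‖z - z₀‖ < δ := by simpa [dist_eq_norm] using hz
      linarith
    have : resolventDeriv 0 s z = z / (s * (s + z)) := by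
      simp [resolventDeriv]; field_simp; ring
    rw [this, if_pos rfl, norm_div, norm_mul, Complex.norm_real, Real.norm_of_nonneg hs.le]
    calc ‖z‖ / (s * ‖(s : ℂ) + z‖) ≤ (‖z₀‖ + δ) / (s * (c * (1 + s))) := by gcongr
      _ = _ := by field_simp
  · rw [resolventDeriv, if_neg hk, if_neg hk, zero_sub, norm_neg, norm_mul, norm_mul, norm_pow,
      norm_neg, norm_one, one_pow, one_mul, norm_inv, norm_pow, Complex.norm_natCast]
    have h1 : s * (1 + s) ≤ (1 + s) ^ (k + 1) := by
      calc s * (1 + s) ≤ (1 + s) ^ 2 := by nlinarith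
        _ ≤ (1 + s) ^ (k + 1) := pow_le_pow_right₀ (by linarith) (by omega)
    calc (k.factorial : ℝ) * (‖(s : ℂ) + z‖ ^ (k + 1))⁻¹
        ≤ k.factorial * ((c * (1 + s)) ^ (k + 1))⁻¹ := by gcongr
      _ = k.factorial / c ^ (k + 1) * (1 / (1 + s) ^ (k + 1)) := by rw [mul_pow]; field_simp
      _ ≤ _ := by gcongr

variable {t : ℝ}

theorem norm_rpow_mul_resolventDeriv_le {k : ℕ} {s : ℝ} (hs : 0 < s) {z : ℂ} {K : ℝ}
    (h : ‖resolventDeriv k s z‖ ≤ K * (s⁻¹ - (s + 1)⁻¹)) :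
    ‖((s ^ t : ℝ) : ℂ) * resolventDeriv k s z‖ ≤ K * Real.rpowIntegrand₀₁ t s 1 := by
  rw [norm_mul, Complex.norm_real, Real.norm_of_nonneg (by positivity), Real.rpowIntegrand₀₁]
  calc s ^ t * ‖resolventDeriv k s z‖ ≤ s ^ t * (K * (s⁻¹ - (s + 1)⁻¹)) := by gcongr
    _ = _ := by ring

theorem aestronglyMeasurable_resolventDeriv (ht : t ∈ Ioo (0 : ℝ) 1) (k : ℕ) {z : ℂ}
    (hz : z ∈ Complex.slitPlane) :
    AEStronglyMeasurable (fun s : ℝ => ((s ^ t : ℝ) : ℂ) * resolventDeriv k s z)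
      (volume.restrict (Ioi 0)) := by
  refine ContinuousOn.aestronglyMeasurable ?_ measurableSet_Ioi
  have hne : ∀ s ∈ Ioi (0 : ℝ), (s : ℂ) + z ≠ 0 := fun s hs =>
    Complex.slitPlane_ne_zero (ofReal_add_mem_slitPlane hz (le_of_lt hs))
  have hs0 : ∀ s ∈ Ioi (0 : ℝ), (s : ℂ) ≠ 0 := fun s hs => by exact_mod_cast (ne_of_gt hs)
  refine ContinuousOn.mul ?_ ?_
  · exact Complex.continuous_ofReal.comp_continuousOn
      (continuousOn_id.rpow_const fun s hs => Or.inr ht.1.le)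
  · unfold resolventDeriv
    refine ContinuousOn.sub ?_ ?_
    · split_ifs
      · exact Complex.continuous_ofReal.continuousOn.inv₀ hs0
      · exact continuousOn_const
    · refine continuousOn_const.mul (ContinuousOn.inv₀ (by fun_prop) fun s hs =>
        pow_ne_zero _ (hne s hs))

theorem integrableOn_resolventDeriv (ht : t ∈ Ioo (0 : ℝ) 1) (k : ℕ) {z : ℂ}
    (hz : z ∈ Complex.slitPlane) :
    IntegrableOn (fun s : ℝ => ((s ^ t : ℝ) : ℂ) * resolventDeriv k s z) (Ioi 0) := by
  obtain ⟨δ, hδ, K, -, hK⟩ := exists_bound_resolventDeriv hz k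
  refine Integrable.mono' ((Real.integrableOn_rpowIntegrand₀₁_Ioi ht zero_le_one).const_mul K)
    (aestronglyMeasurable_resolventDeriv ht k hz) ?_
  exact ae_restrict_of_forall_mem measurableSet_Ioi fun s hs =>
    norm_rpow_mul_resolventDeriv_le hs (hK z (Metric.mem_ball_self hδ) s hs)

theorem hasDerivAt_integral_resolventDeriv (ht : t ∈ Ioo (0 : ℝ) 1) (k : ℕ) {z : ℂ}
    (hz : z ∈ Complex.slitPlane) :
    HasDerivAt (fun z => ∫ s in Ioi (0 : ℝ), ((s ^ t : ℝ) : ℂ) * resolventDeriv k s z)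
      (∫ s in Ioi (0 : ℝ), ((s ^ t : ℝ) : ℂ) * resolventDeriv (k + 1) s z) z := by
  obtain ⟨δ, hδ, K, hsub, hK⟩ := exists_bound_resolventDeriv hz (k + 1)
  refine (hasDerivAt_integral_of_dominated_loc_of_deriv_le (Metric.ball_mem_nhds z hδ)
    (F := fun z s => ((s ^ t : ℝ) : ℂ) * resolventDeriv k s z)
    (F' := fun z s => ((s ^ t : ℝ) : ℂ) * resolventDeriv (k + 1) s z) (bound := fun s => K * Real.rpowIntegrand₀₁ t s 1) ?_ (integrableOn_resolventDeriv ht k hz)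
    (aestronglyMeasurable_resolventDeriv ht (k + 1) hz) ?_
    ((Real.integrableOn_rpowIntegrand₀₁_Ioi ht zero_le_one).const_mul K) ?_).2
  · filter_upwards [Complex.isOpen_slitPlane.mem_nhds hz] with w hw
    exact aestronglyMeasurable_resolventDeriv ht k hw
  · exact ae_restrict_of_forall_mem measurableSet_Ioi fun s hs w hw =>
      norm_rpow_mul_resolventDeriv_le hs (hK w hw s hs)
  · exact ae_restrict_of_forall_mem measurableSet_Ioi fun s hs w hw =>
      (hasDerivAt_resolventDeriv k (le_of_lt hs) (hsub hw)).const_mul _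

/-- Identity theorem: both sides are analytic on the connected slit plane and agree at the points 1
+ 1/(n+1), which accumulate at 1, by the real formula. -/
theorem cpow_eq_const_mul_integral (ht : t ∈ Ioo (0 : ℝ) 1) {z : ℂ}
    (hz : z ∈ Complex.slitPlane) :
    z ^ (t : ℂ) = (((∫ s in Ioi 0, Real.rpowIntegrand₀₁ t s 1)⁻¹ : ℝ) : ℂ) *
      ∫ s in Ioi (0 : ℝ), ((s ^ t : ℝ) : ℂ) * resolventDeriv 0 s z := by
  set c : ℝ := (∫ s in Ioi 0, Real.rpowIntegrand₀₁ t s 1)⁻¹ with hc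
  have hpos : ∀ x : ℝ, 0 < x → (x : ℂ) ^ (t : ℂ) = (c : ℂ) *
      ∫ s in Ioi (0 : ℝ), ((s ^ t : ℝ) : ℂ) * resolventDeriv 0 s x := by
    intro x hx
    rw [← Complex.ofReal_cpow hx.le, Real.rpow_eq_const_mul_integral ht hx.le, ← hc,
      Complex.ofReal_mul, ← integral_complex_ofReal]
    congr 1
    refine setIntegral_congr_fun measurableSet_Ioi fun s hs => ?_
    simp [Real.rpowIntegrand₀₁, resolventDeriv]
  refine AnalyticOnNhd.eqOn_of_preconnected_of_frequently_eq (U := Complex.slitPlane)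
    (f := fun z => z ^ (t : ℂ)) (g := fun z => (c : ℂ) *
      ∫ s in Ioi (0 : ℝ), ((s ^ t : ℝ) : ℂ) * resolventDeriv 0 s z) (z₀ := 1) ?_ ?_
    (Complex.starConvex_one_slitPlane.isPathConnected
      Complex.one_mem_slitPlane).isConnected.isPreconnected Complex.one_mem_slitPlane ?_ hz
  · refine DifferentiableOn.analyticOnNhd (fun w hw => ?_) Complex.isOpen_slitPlane
    exact (differentiableAt_id.cpow_const hw).differentiableWithinAt
  · refine DifferentiableOn.analyticOnNhd (fun w hw => ?_) Complex.isOpen_slitPlane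
    exact ((hasDerivAt_integral_resolventDeriv ht 0 hw).differentiableAt.const_mul
      _).differentiableWithinAt
  · have hu : Filter.Tendsto (fun n : ℕ => ((1 + 1 / ((n : ℝ) + 1) : ℝ) : ℂ)) Filter.atTop
        (nhdsWithin 1 {1}ᶜ) := by
      refine tendsto_nhdsWithin_iff.2 ⟨?_, Filter.Eventually.of_forall fun n => ?_⟩
      · have : Filter.Tendsto (fun n : ℕ => 1 + 1 / ((n : ℝ) + 1)) Filter.atTop (nhds 1) := by
          simpa using tendsto_one_div_add_atTop_nhds_zero_nat.const_add (1 : ℝ)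
        simpa [Function.comp_def] using (Complex.continuous_ofReal.tendsto 1).comp this
      · have : (0 : ℝ) < 1 / ((n : ℝ) + 1) := by positivity
        simp only [mem_compl_iff, mem_singleton_iff]
        intro h
        have : (1 + 1 / ((n : ℝ) + 1) : ℝ) = 1 := by exact_mod_cast h
        linarith
    exact hu.frequently (Filter.Frequently.of_forall fun n => hpos _ (by positivity))

/-- Jets of the power are integrals of jets of the resolvent expression. Since functionals of `f(A)`
are finite combinations of jets, this transfers the scalar formula to non-diagonalizable matrices
without a matrix-valued integral. -/
theorem iteratedDeriv_cpow_eq (ht : t ∈ Ioo (0 : ℝ) 1) (k : ℕ) {z : ℂ}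
    (hz : z ∈ Complex.slitPlane) :
    iteratedDeriv k (fun z : ℂ => z ^ (t : ℂ)) z =
      (((∫ s in Ioi 0, Real.rpowIntegrand₀₁ t s 1)⁻¹ : ℝ) : ℂ) *
        ∫ s in Ioi (0 : ℝ), ((s ^ t : ℝ) : ℂ) * iteratedDeriv k (resolventDeriv 0 s) z := by
  have h1 : ∀ s ∈ Ioi (0 : ℝ), ((s ^ t : ℝ) : ℂ) * iteratedDeriv k (resolventDeriv 0 s) z =
      ((s ^ t : ℝ) : ℂ) * resolventDeriv k s z := fun s hs => by
    rw [iteratedDeriv_eq_of_hasDerivAt Complex.isOpen_slitPlane (F := fun k => resolventDeriv k s)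
      (fun k w hw => hasDerivAt_resolventDeriv k (le_of_lt hs) hw) k z hz]
  rw [setIntegral_congr_fun measurableSet_Ioi h1]
  refine Eq.trans (Filter.EventuallyEq.iteratedDeriv_eq k
    (Filter.eventuallyEq_of_mem (Complex.isOpen_slitPlane.mem_nhds hz)
      fun w hw => cpow_eq_const_mul_integral ht hw)) ?_
  exact iteratedDeriv_eq_of_hasDerivAt Complex.isOpen_slitPlane
    (F := fun k z => (((∫ s in Ioi 0, Real.rpowIntegrand₀₁ t s 1)⁻¹ : ℝ) : ℂ) *
        ∫ s in Ioi (0 : ℝ), ((s ^ t : ℝ) : ℂ) * resolventDeriv k s z)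
    (fun k w hw => (hasDerivAt_integral_resolventDeriv ht k hw).const_mul _) k z hz

end PowerIntegral

/-! ### Geometric means of strictly accretive matrices and their lower bounds. -/

section GeometricMean

variable {m : Type*} [Fintype m]

theorem re_star_dotProduct_conjTranspose_mulVec (A : Matrix m m ℂ) (x : m → ℂ) :
    (star x ⬝ᵥ (Aᴴ *ᵥ x)).re = (star x ⬝ᵥ (A *ᵥ x)).re := by
  have : star x ⬝ᵥ (Aᴴ *ᵥ x) = star (star x ⬝ᵥ (A *ᵥ x)) := by
    rw [Matrix.star_dotProduct, Matrix.star_mulVec, ← Matrix.dotProduct_mulVec]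
    simp
  rw [this]
  simp

theorem re_star_dotProduct_rePart_mulVec (A : Matrix m m ℂ) (x : m → ℂ) :
    (star x ⬝ᵥ (rePart A *ᵥ x)).re = (star x ⬝ᵥ (A *ᵥ x)).re := by
  rw [rePart, Matrix.smul_mulVec, Matrix.add_mulVec, dotProduct_smul, dotProduct_add, smul_eq_mul]
  have h : (1 / 2 : ℂ) = ((1 / 2 : ℝ) : ℂ) := by norm_num
  rw [h, Complex.re_ofReal_mul, Complex.add_re, re_star_dotProduct_conjTranspose_mulVec]
  ring

theorem IsStrictlyAccretive.re_pos {A : Matrix m m ℂ} (hA : IsStrictlyAccretive A) {x : m → ℂ}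
    (hx : x ≠ 0) : 0 < (star x ⬝ᵥ (A *ᵥ x)).re := by
  rw [← re_star_dotProduct_rePart_mulVec]
  exact Matrix.PosDef.re_dotProduct_pos hA hx

variable [DecidableEq m]

theorem exists_eigenvector_of_isRoot {A : Matrix m m ℂ} {μ : ℂ} (h : A.charpoly.IsRoot μ) :
    ∃ v ≠ 0, A *ᵥ v = μ • v := by
  rw [Polynomial.IsRoot, Matrix.eval_charpoly] at h
  obtain ⟨v, hv, h0⟩ := Matrix.exists_mulVec_eq_zero_iff.2 h
  refine ⟨v, hv, ?_⟩
  rw [Matrix.sub_mulVec, sub_eq_zero] at h0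
  rw [← h0]
  simp [Matrix.scalar_apply, ← Matrix.smul_one_eq_diagonal, Matrix.smul_mulVec]

theorem IsStrictlyAccretive.mem_slitPlane {A : Matrix m m ℂ} (hA : IsStrictlyAccretive A) {μ : ℂ}
    (h : A.charpoly.IsRoot μ) : μ ∈ Complex.slitPlane := by
  obtain ⟨v, hv, hAv⟩ := exists_eigenvector_of_isRoot h
  have h1 := hA.re_pos hv
  have h2 : 0 < star v ⬝ᵥ v := Matrix.dotProduct_star_self_pos_iff.2 hv
  obtain ⟨h3, h4⟩ := Complex.pos_iff.1 h2
  rw [hAv, dotProduct_smul, smul_eq_mul, Complex.mul_re, ← h4, mul_zero, sub_zero] at h1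
  exact Or.inl (pos_of_mul_pos_left h1 h3.le)

theorem analyticAt_cpow_const {z : ℂ} (hz : z ∈ Complex.slitPlane) (c : ℂ) :
    AnalyticAt ℂ (fun z : ℂ => z ^ c) z := by
  fun_prop (disch := assumption)

theorem matPow_mul_matPow {A : Matrix m m ℂ} (hA : ∀ μ, A.charpoly.IsRoot μ → μ ∈ Complex.slitPlane)
    (p q : ℝ) : matPow A p * matPow A q = matPow A (p + q) := by
  unfold matPow
  rw [matFun_mul (fun μ h => analyticAt_cpow_const (hA μ h) _)
    (fun μ h => analyticAt_cpow_const (hA μ h) _)]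
  refine matFun_congr fun μ h => Filter.eventuallyEq_of_mem
    (Complex.isOpen_slitPlane.mem_nhds (hA μ h)) fun z hz => ?_
  simp [Complex.cpow_add _ _ (Complex.slitPlane_ne_zero hz)]

theorem matPow_zero (A : Matrix m m ℂ) : matPow A 0 = 1 := by
  simpa [matPow] using matFun_const 1 A

theorem matPow_one (A : Matrix m m ℂ) : matPow A 1 = A := by
  simpa [matPow] using matFun_id A

section

variable {A B : Matrix m m ℂ} (hA : IsStrictlyAccretive A)
include hA

theorem IsStrictlyAccretive.sqrt_mul_sqrt : matPow A (1 / 2) * matPow A (1 / 2) = A := by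
  rw [matPow_mul_matPow fun μ => hA.mem_slitPlane, add_halves, matPow_one]

theorem IsStrictlyAccretive.sqrt_mul_invSqrt : matPow A (1 / 2) * matPow A (-(1 / 2)) = 1 := by
  rw [matPow_mul_matPow fun μ => hA.mem_slitPlane, add_neg_cancel, matPow_zero]

theorem IsStrictlyAccretive.invSqrt_mul_sqrt : matPow A (-(1 / 2)) * matPow A (1 / 2) = 1 := by
  rw [matPow_mul_matPow fun μ => hA.mem_slitPlane, neg_add_cancel, matPow_zero]

theorem IsStrictlyAccretive.sqrt_mul_middle_mul_sqrt (B : Matrix m m ℂ) :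
    matPow A (1 / 2) * (matPow A (-(1 / 2)) * B * matPow A (-(1 / 2))) * matPow A (1 / 2) = B := by
  calc _ = (matPow A (1 / 2) * matPow A (-(1 / 2))) * B *
      (matPow A (-(1 / 2)) * matPow A (1 / 2)) := by simp only [mul_assoc]
    _ = B := by rw [hA.sqrt_mul_invSqrt, hA.invSqrt_mul_sqrt, one_mul, mul_one]

theorem geomMean_zero : geomMean 0 A B = A := by
  rw [geomMean, matPow_zero, mul_one, hA.sqrt_mul_sqrt]

theorem geomMean_one : geomMean 1 A B = B := by
  rw [geomMean, matPow_one, hA.sqrt_mul_middle_mul_sqrt]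

/-- An eigenvector v for μ gives w = A^(-1/2) v with Bw = μAw. If μ were real and nonpositive, the
positive real parts of w*Aw and w*Bw would contradict each other. -/
theorem IsStrictlyAccretive.middle_mem_slitPlane (hB : IsStrictlyAccretive B) {μ : ℂ}
    (h : (matPow A (-(1 / 2)) * B * matPow A (-(1 / 2))).charpoly.IsRoot μ) :
    μ ∈ Complex.slitPlane := by
  obtain ⟨v, hv, hCv⟩ := exists_eigenvector_of_isRoot h
  by_contra hμ
  rw [Complex.mem_slitPlane_iff, not_or, not_lt, not_not] at hμ
  set w := matPow A (-(1 / 2)) *ᵥ v with hw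
  have hvw : v = matPow A (1 / 2) *ᵥ w := by
    rw [hw, Matrix.mulVec_mulVec, hA.sqrt_mul_invSqrt, Matrix.one_mulVec]
  have hw0 : w ≠ 0 := fun h0 => hv (by rw [hvw, h0, Matrix.mulVec_zero])
  have hBw : B *ᵥ w = μ • (A *ᵥ w) := by
    have := congrArg (matPow A (1 / 2) *ᵥ ·) hCv
    rw [Matrix.mulVec_smul, hvw] at this
    simp only [Matrix.mulVec_mulVec, hA.sqrt_mul_sqrt] at this
    rw [← mul_assoc, hA.sqrt_mul_middle_mul_sqrt] at this
    exact this
  have h1 := hB.re_pos hw0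
  have h2 := hA.re_pos hw0
  rw [hBw, dotProduct_smul, smul_eq_mul, Complex.mul_re, hμ.2, zero_mul, sub_zero] at h1
  nlinarith [hμ.1]

end

theorem add_mul_matFun_resolventDeriv {C : Matrix m m ℂ}
    (hC : ∀ μ, C.charpoly.IsRoot μ → μ ∈ Complex.slitPlane) {s : ℝ} (hs : 0 < s) :
    ((s : ℂ) • (1 : Matrix m m ℂ) + C) * matFun (resolventDeriv 0 s) C = (s : ℂ)⁻¹ • C := by
  have h1 : matFun (fun z => (s : ℂ) + z) C = (s : ℂ) • (1 : Matrix m m ℂ) + C := by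
    have := matFun_polynomial (Polynomial.C (s : ℂ) + Polynomial.X) C
    simp only [Polynomial.eval_add, Polynomial.eval_C, Polynomial.eval_X] at this
    rw [this, map_add, Polynomial.aeval_C, Polynomial.aeval_X, Algebra.algebraMap_eq_smul_one]
  have h2 : matFun (fun z => (s : ℂ)⁻¹ * z) C = (s : ℂ)⁻¹ • C := by
    have := matFun_polynomial (Polynomial.C (s : ℂ)⁻¹ * Polynomial.X) C
    simp only [Polynomial.eval_mul, Polynomial.eval_C, Polynomial.eval_X] at this
    rw [this, map_mul, Polynomial.aeval_C, Polynomial.aeval_X, Algebra.algebraMap_eq_smul_one,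
      Matrix.smul_mul, one_mul]
  rw [← h1, ← h2, matFun_mul (fun μ _ => by fun_prop)]
  · refine matFun_congr fun μ h => Filter.eventuallyEq_of_mem
      (Complex.isOpen_slitPlane.mem_nhds (hC μ h)) fun z hz => ?_
    have hne := Complex.slitPlane_ne_zero (ofReal_add_mem_slitPlane hz hs.le)
    have hs0 : (s : ℂ) ≠ 0 := by exact_mod_cast hs.ne'
    simp only [Pi.mul_apply, resolventDeriv]
    simp
    field_simp
    ring
  · intro μ h
    exact (DifferentiableOn.analyticOnNhd (fun w hw =>
      (hasDerivAt_resolventDeriv 0 hs.le hw).differentiableAt.differentiableWithinAt)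
      Complex.isOpen_slitPlane) μ (hC μ h)

/-- With Y = A^(1/2) (s⁻¹ - (s + C)⁻¹) A^(1/2), where C = A^(-1/2) B A^(-1/2), one has Au = Bw = sYx
for the chosen vectors: Y is the parallel sum of s⁻¹A and s⁻²B. Substituting x = u + s w on the left
of x*Yx splits the form. -/
theorem exists_form_eq {A B : Matrix m m ℂ} (hA : IsStrictlyAccretive A)
    (hB : IsStrictlyAccretive B) {s : ℝ} (hs : 0 < s) (x : m → ℂ) :
    ∃ u w : m → ℂ, x = u + (s : ℂ) • w ∧
      star x ⬝ᵥ ((matPow A (1 / 2) * matFun (resolventDeriv 0 s)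
        (matPow A (-(1 / 2)) * B * matPow A (-(1 / 2))) * matPow A (1 / 2)) *ᵥ x) =
      (s : ℂ)⁻¹ * (star u ⬝ᵥ (A *ᵥ u)) + star w ⬝ᵥ (B *ᵥ w) := by
  have hs0 : (s : ℂ) ≠ 0 := by exact_mod_cast hs.ne'
  have hM := add_mul_matFun_resolventDeriv (fun μ => hA.middle_mem_slitPlane hB (μ := μ)) hs
  have hRCR := hA.sqrt_mul_middle_mul_sqrt B
  have hRR := hA.sqrt_mul_sqrt
  have hRT := hA.sqrt_mul_invSqrt
  have hTR := hA.invSqrt_mul_sqrt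
  set R := matPow A (1 / 2)
  set T := matPow A (-(1 / 2))
  set C := T * B * T
  set M := matFun (resolventDeriv 0 s) C
  have hAT : A * T = R := by rw [← hRR, mul_assoc, hRT, mul_one]
  have hBT : B * T = R * C := by
    rw [← hRCR, mul_assoc, hRT, mul_one]
  have hC : C = (s : ℂ) • ((s : ℂ) • M + C * M) := by
    rw [add_mul, Matrix.smul_mul, one_mul] at hM
    rw [hM, smul_smul, mul_inv_cancel₀ hs0, one_smul]
  -- This is s A⁻¹(RMR)x, since AT = R; `w` is then forced by x = u + s w.
  set u := (s : ℂ) • ((T * M * R) *ᵥ x) with hu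
  set w := (s : ℂ)⁻¹ • (x - u) with hw
  have hAu : A *ᵥ u = (s : ℂ) • ((R * M * R) *ᵥ x) := by
    rw [hu, Matrix.mulVec_smul, Matrix.mulVec_mulVec, ← mul_assoc, ← mul_assoc, hAT]
  have hBw : B *ᵥ w = (s : ℂ) • ((R * M * R) *ᵥ x) := by
    have h1 : B - (s : ℂ) • (R * C * M * R) = ((s : ℂ) * s) • (R * M * R) := by
      calc B - (s : ℂ) • (R * C * M * R) = R * (C - (s : ℂ) • (C * M)) * R := by
            rw [← hRCR]; simp only [mul_sub, sub_mul, Matrix.mul_smul, Matrix.smul_mul, mul_assoc]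
        _ = R * (((s : ℂ) * s) • M) * R := by
            congr 2
            nth_rewrite 1 [hC]
            rw [smul_add, add_sub_cancel_right, smul_smul]
        _ = _ := by simp only [Matrix.mul_smul, Matrix.smul_mul]
    rw [hw, Matrix.mulVec_smul, Matrix.mulVec_sub, hu, Matrix.mulVec_smul, Matrix.mulVec_mulVec,
      ← mul_assoc, ← mul_assoc, hBT, ← Matrix.smul_mulVec, ← Matrix.sub_mulVec, h1,
      ← Matrix.smul_mulVec, smul_smul, ← mul_assoc, inv_mul_cancel₀ hs0, one_mul,
      Matrix.smul_mulVec]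
  have hx : x = u + (s : ℂ) • w := by
    rw [hw, smul_smul, mul_inv_cancel₀ hs0, one_smul, add_sub_cancel]
  refine ⟨u, w, hx, ?_⟩
  rw [hAu, hBw, dotProduct_smul, dotProduct_smul, smul_eq_mul, smul_eq_mul, ← mul_assoc,
    inv_mul_cancel₀ hs0, one_mul]
  nth_rewrite 1 [hx]
  rw [star_add, star_smul, add_dotProduct, smul_dotProduct]
  simp

/-- Scalar variational inequality for the parallel sum; after clearing denominators the gap for
norms is s(‖a‖ - r‖b‖)². -/
theorem parallel_sum_le {e r s : ℝ} (he : 0 < e) (hr : 0 < r) (hs : 0 < s) (a b : ℂ) :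
    e * (s⁻¹ - (s + r)⁻¹) * ‖a + (s : ℂ) * b‖ ^ 2 ≤ s⁻¹ * (e * ‖a‖ ^ 2) + e * r * ‖b‖ ^ 2 := by
  have h1 : ‖a + (s : ℂ) * b‖ ≤ ‖a‖ + s * ‖b‖ := by
    refine (norm_add_le _ _).trans_eq ?_
    rw [norm_mul, Complex.norm_real, Real.norm_of_nonneg hs.le]
  have h2 : s⁻¹ - (s + r)⁻¹ = r / (s * (s + r)) := by field_simp; ring
  rw [h2]
  calc e * (r / (s * (s + r))) * ‖a + (s : ℂ) * b‖ ^ 2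
      ≤ e * (r / (s * (s + r))) * (‖a‖ + s * ‖b‖) ^ 2 := by gcongr
    _ = (e / (s * (s + r))) * (r * (‖a‖ + s * ‖b‖) ^ 2) := by ring
    _ ≤ (e / (s * (s + r))) * ((s + r) * (‖a‖ ^ 2 + s * r * ‖b‖ ^ 2)) := by
        refine mul_le_mul_of_nonneg_left ?_ (by positivity)
        nlinarith [mul_nonneg hs.le (sq_nonneg (‖a‖ - r * ‖b‖))]
    _ = _ := by field_simp

open MeasureTheory Set in
/-- Lower bounds for the real parts of `A` and `B` by quadratic forms that are diagonal in the
same coordinates pass to the weighted geometric mean. -/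
theorem sum_le_re_geomMean {A B : Matrix m m ℂ} (hA : IsStrictlyAccretive A)
    (hB : IsStrictlyAccretive B) {t : ℝ} (ht : t ∈ Icc (0 : ℝ) 1) (Z : Matrix m m ℂ) {e r : m → ℝ}
    (he : ∀ i, 0 < e i) (hr : ∀ i, 0 < r i)
    (hAZ : ∀ x, ∑ i, e i * ‖(Z *ᵥ x) i‖ ^ 2 ≤ (star x ⬝ᵥ (A *ᵥ x)).re)
    (hBZ : ∀ x, ∑ i, e i * r i * ‖(Z *ᵥ x) i‖ ^ 2 ≤ (star x ⬝ᵥ (B *ᵥ x)).re) (x : m → ℂ) :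
    ∑ i, e i * r i ^ t * ‖(Z *ᵥ x) i‖ ^ 2 ≤ (star x ⬝ᵥ (geomMean t A B *ᵥ x)).re := by
  -- The integral formula needs 0 < t < 1, so the endpoints are treated separately.
  rcases eq_or_lt_of_le ht.1 with rfl | ht0
  · simpa [geomMean_zero hA] using hAZ x
  rcases eq_or_lt_of_le ht.2 with rfl | ht1
  · simpa [geomMean_one hA] using hBZ x
  have ht' : t ∈ Ioo (0 : ℝ) 1 := ⟨ht0, ht1⟩
  set R := matPow A (1 / 2) with hR
  set C := matPow A (-(1 / 2)) * B * matPow A (-(1 / 2)) with hC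
  let φ : Matrix m m ℂ →ₗ[ℂ] ℂ :=
    { toFun := fun Y => star x ⬝ᵥ ((R * Y * R) *ᵥ x)
      map_add' := fun Y Y' => by
        rw [mul_add, add_mul, Matrix.add_mulVec, dotProduct_add]
      map_smul' := fun c Y => by
        rw [Matrix.mul_smul, Matrix.smul_mul, Matrix.smul_mulVec, dotProduct_smul]; rfl }
  obtain ⟨ι, _, μ, k, a, hμ, hφ⟩ := exists_matFun_eq_sum C φ
  have hμ' : ∀ i, μ i ∈ Complex.slitPlane := fun i => hA.middle_mem_slitPlane hB (hμ i)
  set c : ℝ := (∫ s in Ioi 0, Real.rpowIntegrand₀₁ t s 1)⁻¹ with hc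
  have hcpos : 0 < c := inv_pos.2 (Real.integral_rpowIntegrand₀₁_one_pos ht')
  have hjet : ∀ i, ∀ s ∈ Ioi (0 : ℝ), iteratedDeriv (k i) (resolventDeriv 0 s) (μ i) =
      resolventDeriv (k i) s (μ i) := fun i s hs =>
    iteratedDeriv_eq_of_hasDerivAt Complex.isOpen_slitPlane (F := fun k => resolventDeriv k s)
      (fun k w hw => hasDerivAt_resolventDeriv k (le_of_lt hs) hw) (k i) _ (hμ' i)
  have hint : ∀ i, IntegrableOn (fun s : ℝ => ((s ^ t : ℝ) : ℂ) *
      iteratedDeriv (k i) (resolventDeriv 0 s) (μ i)) (Ioi 0) := fun i =>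
    (integrableOn_congr_fun (fun s hs => by rw [hjet i s hs]) measurableSet_Ioi).2
      (integrableOn_resolventDeriv ht' (k i) (hμ' i))
  have hsum : ∀ s : ℝ, ((s ^ t : ℝ) : ℂ) * φ (matFun (resolventDeriv 0 s) C) =
      ∑ i, a i * (((s ^ t : ℝ) : ℂ) * iteratedDeriv (k i) (resolventDeriv 0 s) (μ i)) := by
    intro s
    rw [hφ, Finset.mul_sum]
    exact Finset.sum_congr rfl fun i _ => by ring
  have hintφ : IntegrableOn (fun s : ℝ => ((s ^ t : ℝ) : ℂ) * φ (matFun (resolventDeriv 0 s) C))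
      (Ioi 0) := by
    simp only [hsum]
    exact integrable_finsetSum _ fun i _ => (hint i).const_mul _
  -- Expanding the form into finitely many jets lets the integral be pulled out of a finite sum.
  have hrep : star x ⬝ᵥ (geomMean t A B *ᵥ x) = (c : ℂ) *
      ∫ s in Ioi (0 : ℝ), ((s ^ t : ℝ) : ℂ) * φ (matFun (resolventDeriv 0 s) C) := by
    have h1 : star x ⬝ᵥ (geomMean t A B *ᵥ x) = φ (matFun (fun z => z ^ (t : ℂ)) C) := rfl
    rw [h1, hφ]
    simp only [hsum]
    rw [integral_finsetSum _ fun i _ => (hint i).const_mul _, Finset.mul_sum]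
    refine Finset.sum_congr rfl fun i _ => ?_
    rw [iteratedDeriv_cpow_eq ht' _ (hμ' i), integral_const_mul]
    ring
  -- Pointwise in `s`, the bounds for `A` and `B` are used at `u` and `w`; integration against `s ^
  -- t` then restores `r i ^ t`.
  have hlow : ∀ s ∈ Ioi (0 : ℝ), ∑ i, e i * ‖(Z *ᵥ x) i‖ ^ 2 * Real.rpowIntegrand₀₁ t s (r i) ≤
      (((s ^ t : ℝ) : ℂ) * φ (matFun (resolventDeriv 0 s) C)).re := by
    intro s hs
    rw [mem_Ioi] at hs
    obtain ⟨u, w, hx, hform⟩ := exists_form_eq hA hB hs x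
    have hφ' : φ (matFun (resolventDeriv 0 s) C) =
      (s : ℂ)⁻¹ * (star u ⬝ᵥ (A *ᵥ u)) + star w ⬝ᵥ (B *ᵥ w) := hform
    rw [Complex.re_ofReal_mul, hφ', Complex.add_re, ← Complex.ofReal_inv, Complex.re_ofReal_mul]
    calc ∑ i, e i * ‖(Z *ᵥ x) i‖ ^ 2 * Real.rpowIntegrand₀₁ t s (r i)
        = s ^ t * ∑ i, e i * (s⁻¹ - (s + r i)⁻¹) * ‖(Z *ᵥ u) i + (s : ℂ) * (Z *ᵥ w) i‖ ^ 2 := by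
          rw [Finset.mul_sum]
          refine Finset.sum_congr rfl fun i _ => ?_
          have : (Z *ᵥ x) i = (Z *ᵥ u) i + (s : ℂ) * (Z *ᵥ w) i := by
            rw [hx, Matrix.mulVec_add, Matrix.mulVec_smul]; rfl
          rw [this, Real.rpowIntegrand₀₁]
          ring
      _ ≤ s ^ t * ∑ i, (s⁻¹ * (e i * ‖(Z *ᵥ u) i‖ ^ 2) + e i * r i * ‖(Z *ᵥ w) i‖ ^ 2) := by
          gcongr with i
          exact parallel_sum_le (he i) (hr i) hs _ _
      _ = s ^ t * (s⁻¹ * ∑ i, e i * ‖(Z *ᵥ u) i‖ ^ 2 + ∑ i, e i * r i * ‖(Z *ᵥ w) i‖ ^ 2) := by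
          rw [Finset.sum_add_distrib, Finset.mul_sum Finset.univ _ s⁻¹]
      _ ≤ _ := by
          gcongr
          · exact hAZ u
          · exact hBZ w
  have hlowint : ∀ i ∈ Finset.univ, IntegrableOn (fun s =>
      e i * ‖(Z *ᵥ x) i‖ ^ 2 * Real.rpowIntegrand₀₁ t s (r i)) (Ioi 0) := fun i _ =>
    (Real.integrableOn_rpowIntegrand₀₁_Ioi ht' (hr i).le).const_mul _
  calc ∑ i, e i * r i ^ t * ‖(Z *ᵥ x) i‖ ^ 2
      = c * ∫ s in Ioi (0 : ℝ), ∑ i, e i * ‖(Z *ᵥ x) i‖ ^ 2 * Real.rpowIntegrand₀₁ t s (r i) := by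
        rw [integral_finsetSum _ hlowint, Finset.mul_sum]
        refine Finset.sum_congr rfl fun i _ => ?_
        rw [integral_const_mul, Real.rpow_eq_const_mul_integral ht' (hr i).le, ← hc]
        ring
    _ ≤ c * ∫ s in Ioi (0 : ℝ), (((s ^ t : ℝ) : ℂ) * φ (matFun (resolventDeriv 0 s) C)).re := by
        refine mul_le_mul_of_nonneg_left ?_ hcpos.le
        exact setIntegral_mono_on (integrable_finsetSum _ hlowint) hintφ.re measurableSet_Ioi hlow
    _ = (star x ⬝ᵥ (geomMean t A B *ᵥ x)).re := by
        rw [hrep, Complex.re_ofReal_mul]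
        congr 1
        exact integral_re hintφ

end GeometricMean

/-! ### Accretive block matrices and the inheritance of APT by geometric means. -/

section BlockMatrices

variable {m : Type*} [Fintype m]

theorem IsAccretive.re_nonneg {A : Matrix m m ℂ} (hA : IsAccretive A) (x : m → ℂ) :
    0 ≤ (star x ⬝ᵥ (A *ᵥ x)).re := by
  by_cases hx : x = 0
  · simp [hx]
  set y : EuclideanSpace ℂ m := WithLp.toLp 2 x with hy
  have hy0 : ‖y‖ ≠ 0 := by
    rw [norm_ne_zero_iff]
    exact fun h => hx (by simpa [hy] using congrArg WithLp.ofLp h)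
  have h1 : ‖((‖y‖⁻¹ : ℝ) : ℂ) • y‖ = 1 := by
    rw [norm_smul, Complex.norm_real, norm_inv, norm_norm, inv_mul_cancel₀ hy0]
  have h2 := hA ⟨_, h1, rfl⟩
  rw [Set.mem_ofPred_eq] at h2
  have h3 : (((‖y‖⁻¹ : ℝ) : ℂ) • y).ofLp = ((‖y‖⁻¹ : ℝ) : ℂ) • x := rfl
  rw [h3, star_smul, Matrix.mulVec_smul, smul_dotProduct, dotProduct_smul, smul_eq_mul,
    smul_eq_mul, Complex.star_def, Complex.conj_ofReal, Complex.re_ofReal_mul,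
    Complex.re_ofReal_mul] at h2
  have h4 : 0 < ‖y‖⁻¹ := by positivity
  exact nonneg_of_mul_nonneg_right (nonneg_of_mul_nonneg_right h2 h4) h4

theorem re_star_dotProduct_conjTranspose_mulVec_comm (X : Matrix m m ℂ) (x y : m → ℂ) :
    (star y ⬝ᵥ (Xᴴ *ᵥ x)).re = (star x ⬝ᵥ (X *ᵥ y)).re := by
  have : star y ⬝ᵥ (Xᴴ *ᵥ x) = star (star x ⬝ᵥ (X *ᵥ y)) := by
    rw [Matrix.star_dotProduct, Matrix.star_mulVec, ← Matrix.dotProduct_mulVec]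
    simp
  rw [this]
  simp

theorem IsAccretive.block_nonneg {A B X : Matrix m m ℂ}
    (h : IsAccretive (Matrix.fromBlocks A X Xᴴ B)) (x y : m → ℂ) :
    0 ≤ (star x ⬝ᵥ (A *ᵥ x)).re + 2 * (star x ⬝ᵥ (X *ᵥ y)).re + (star y ⬝ᵥ (B *ᵥ y)).re := by
  have h1 := h.re_nonneg (Sum.elim x y)
  have h2 : star (Sum.elim x y) = Sum.elim (star x) (star y) := by
    funext i; cases i <;> rfl
  rw [Matrix.fromBlocks_mulVec, h2, sumElim_dotProduct_sumElim, dotProduct_add,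
    dotProduct_add, Complex.add_re, Complex.add_re, Complex.add_re] at h1
  simp only [Sum.elim_comp_inl, Sum.elim_comp_inr] at h1
  rw [re_star_dotProduct_conjTranspose_mulVec_comm] at h1
  linarith

/-- This is accretivity of the partial transpose with the two vectors exchanged, so that `X` keeps
its place while `A` and `B` trade theirs. -/
theorem IsAPT.block_nonneg_swap {A B X : Matrix m m ℂ}
    (h : IsAPT (Matrix.fromBlocks A X Xᴴ B)) (x y : m → ℂ) :
    0 ≤ (star x ⬝ᵥ (B *ᵥ x)).re + 2 * (star x ⬝ᵥ (X *ᵥ y)).re + (star y ⬝ᵥ (A *ᵥ y)).re := by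
  have h1 : IsAccretive (Matrix.fromBlocks A Xᴴ Xᴴᴴ B) := by
    simpa [partialTranspose] using h.2
  have h2 := h1.block_nonneg y x
  rw [re_star_dotProduct_conjTranspose_mulVec_comm] at h2
  linarith

theorem dotProduct_conjTranspose_mul_diagonal_mul_mulVec [DecidableEq m] (S : Matrix m m ℂ)
    (d : m → ℝ) (x : m → ℂ) :
    (star x ⬝ᵥ ((Sᴴ * Matrix.diagonal (fun i => (d i : ℂ)) * S) *ᵥ x)).re =
      ∑ i, d i * ‖(S *ᵥ x) i‖ ^ 2 := by
  rw [← Matrix.mulVec_mulVec, ← Matrix.mulVec_mulVec, Matrix.dotProduct_mulVec,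
    ← Matrix.star_mulVec, dotProduct, Complex.re_sum]
  refine Finset.sum_congr rfl fun i _ => ?_
  rw [Matrix.mulVec_diagonal, Pi.star_apply, mul_left_comm, Complex.re_ofReal_mul,
    Complex.star_def, ← Complex.normSq_eq_conj_mul_self, Complex.ofReal_re, Complex.normSq_eq_norm_sq]

variable [DecidableEq m]

theorem exists_conjTranspose_mul_mul_eq_diagonal {P : Matrix m m ℂ} (hP : P.PosDef) :
    ∃ U ∈ Matrix.unitaryGroup m ℂ, ∃ d : m → ℝ, (∀ i, 0 < d i) ∧
      Uᴴ * P * U = Matrix.diagonal (fun i => (d i : ℂ)) := by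
  refine ⟨hP.1.eigenvectorUnitary, hP.1.eigenvectorUnitary.2, hP.1.eigenvalues,
    hP.eigenvalues_pos, ?_⟩
  have := hP.1.conjStarAlgAut_star_eigenvectorUnitary
  rw [Unitary.conjStarAlgAut_apply] at this
  simpa [Function.comp_def, Matrix.star_eq_conjTranspose] using this

theorem exists_conjTranspose_mul_mul_eq_one {P : Matrix m m ℂ} (hP : P.PosDef) :
    ∃ F : Matrix m m ℂ, Fᴴ * P * F = 1 := by
  obtain ⟨U, hU, d, hd, h⟩ := exists_conjTranspose_mul_mul_eq_diagonal hP
  refine ⟨U * Matrix.diagonal (fun i => (((Real.sqrt (d i))⁻¹ : ℝ) : ℂ)), ?_⟩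
  rw [Matrix.conjTranspose_mul, Matrix.diagonal_conjTranspose]
  calc _ = Matrix.diagonal (star fun i => (((Real.sqrt (d i))⁻¹ : ℝ) : ℂ)) * (Uᴴ * P * U) *
      Matrix.diagonal (fun i => (((Real.sqrt (d i))⁻¹ : ℝ) : ℂ)) := by simp only [mul_assoc]
    _ = 1 := by
      rw [h, Matrix.diagonal_mul_diagonal, Matrix.diagonal_mul_diagonal, ← Matrix.diagonal_one]
      congr 1
      funext i
      rw [Pi.star_apply, Complex.star_def, Complex.conj_ofReal]
      norm_cast
      have h1 := Real.mul_self_sqrt (hd i).le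
      have h2 : Real.sqrt (d i) ≠ 0 := (Real.sqrt_pos.2 (hd i)).ne'
      field_simp
      rw [sq, h1]

/-- Two positive definite matrices are simultaneously diagonalized by a congruence. -/
theorem exists_simultaneous_diagonal {P Q : Matrix m m ℂ} (hP : P.PosDef) (hQ : Q.PosDef) :
    ∃ (S T : Matrix m m ℂ) (d : m → ℝ), S * T = 1 ∧ (∀ i, 0 < d i) ∧ P = Sᴴ * S ∧
      Q = Sᴴ * Matrix.diagonal (fun i => (d i : ℂ)) * S := by
  obtain ⟨F, hF⟩ := exists_conjTranspose_mul_mul_eq_one hP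
  have hinj : Function.Injective F.mulVec := by
    refine Function.LeftInverse.injective (g := (Fᴴ * P).mulVec) fun x => ?_
    rw [Matrix.mulVec_mulVec, hF, Matrix.one_mulVec]
  obtain ⟨V, hV, d, hd, h⟩ :=
    exists_conjTranspose_mul_mul_eq_diagonal (hQ.conjTranspose_mul_mul_same hinj)
  have hTP : (F * V)ᴴ * P * (F * V) = 1 := by
    calc _ = Vᴴ * (Fᴴ * P * F) * V := by simp only [Matrix.conjTranspose_mul, mul_assoc]
      _ = 1 := by rw [hF, mul_one]; exact Matrix.mem_unitaryGroup_iff'.1 hV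
  have hTQ : (F * V)ᴴ * Q * (F * V) = Matrix.diagonal (fun i => (d i : ℂ)) := by
    rw [← h]; simp only [Matrix.conjTranspose_mul, mul_assoc]
  set T := F * V
  -- From T*PT = 1, this is the inverse of `T`.
  set S := Tᴴ * P
  have hTS : T * S = 1 := mul_eq_one_comm.1 hTP
  have hTS' : Sᴴ * Tᴴ = 1 := by rw [← Matrix.conjTranspose_mul, hTS, Matrix.conjTranspose_one]
  have key : ∀ R : Matrix m m ℂ, Sᴴ * (Tᴴ * R * T) * S = R := fun R => by
    calc _ = (Sᴴ * Tᴴ) * R * (T * S) := by simp only [mul_assoc]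
      _ = R := by rw [hTS, hTS', one_mul, mul_one]
  refine ⟨S, T, d, hTP, hd, ?_, ?_⟩
  · have := key P
    rw [hTP, mul_one] at this
    exact this.symm
  · rw [← hTQ, key]

/-- Arithmetic-geometric mean inequality with weights p⁻¹ and p for p = d^(1-t). The first weight is
left as `d⁻¹ * d ^ t`, the shape `e * r ^ t` with e = d⁻¹ and r = d. -/
theorem neg_two_mul_re_star_mul_le {d : ℝ} (hd : 0 < d) (t : ℝ) (z w : ℂ) :
    -(2 * (star z * w).re) ≤ d⁻¹ * d ^ t * ‖z‖ ^ 2 + d ^ (1 - t) * ‖w‖ ^ 2 := by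
  have h1 : -(star z * w).re ≤ ‖z‖ * ‖w‖ := by
    have := (abs_le.1 (Complex.abs_re_le_norm (star z * w))).1
    rw [norm_mul, norm_star] at this
    linarith
  have h2 : 0 < d ^ (1 - t) := by positivity
  have h3 : d⁻¹ * d ^ t = (d ^ (1 - t))⁻¹ := by
    rw [Real.rpow_sub hd, Real.rpow_one]; field_simp
  rw [h3]
  set p := d ^ (1 - t)
  have h4 : p⁻¹ * ‖z‖ ^ 2 + p * ‖w‖ ^ 2 - 2 * (‖z‖ * ‖w‖) = p⁻¹ * (‖z‖ - p * ‖w‖) ^ 2 := by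
    field_simp; ring
  have h5 : 0 ≤ p⁻¹ * (‖z‖ - p * ‖w‖) ^ 2 := by positivity
  linarith

/-- For an APT matrix with blocks `A`, `X`, `Xᴴ`, `B`, the block matrix with the diagonal blocks
`A ♯_t B` and `A ♯_(1-t) B` and the off-diagonal blocks `X`, `Xᴴ` is accretive. -/
theorem IsAPT.geomMean_block_nonneg {A B X : Matrix m m ℂ} (hA : IsStrictlyAccretive A)
    (hB : IsStrictlyAccretive B) (h : IsAPT (Matrix.fromBlocks A X Xᴴ B)) {t : ℝ}
    (ht : t ∈ Set.Icc (0 : ℝ) 1) (x y : m → ℂ) :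
    0 ≤ (star x ⬝ᵥ (geomMean t A B *ᵥ x)).re + 2 * (star x ⬝ᵥ (X *ᵥ y)).re +
      (star y ⬝ᵥ (geomMean (1 - t) A B *ᵥ y)).re := by
  obtain ⟨S, T, d, hST, hd, hP, hQ⟩ := exists_simultaneous_diagonal hA hB
  have ha : ∀ x, (star x ⬝ᵥ (A *ᵥ x)).re = ∑ i, ‖(S *ᵥ x) i‖ ^ 2 := fun x => by
    have := dotProduct_conjTranspose_mul_diagonal_mul_mulVec S 1 x
    simp only [Pi.one_apply, Complex.ofReal_one, Matrix.diagonal_one, mul_one, one_mul] at this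
    rw [← re_star_dotProduct_rePart_mulVec, hP, this]
  have hb : ∀ x, (star x ⬝ᵥ (B *ᵥ x)).re = ∑ i, d i * ‖(S *ᵥ x) i‖ ^ 2 := fun x => by
    rw [← re_star_dotProduct_rePart_mulVec, hQ, dotProduct_conjTranspose_mul_diagonal_mul_mulVec]
  set Z := Tᴴ * Xᴴ with hZ
  have hX : ∀ x y, (star x ⬝ᵥ (X *ᵥ y)).re = ∑ i, (star ((Z *ᵥ x) i) * (S *ᵥ y) i).re := by
    intro x y
    have hTS : T * S = 1 := mul_eq_one_comm.1 hST
    have h1 : X = Zᴴ * S := by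
      rw [hZ, Matrix.conjTranspose_mul, Matrix.conjTranspose_conjTranspose,
        Matrix.conjTranspose_conjTranspose, mul_assoc, hTS, mul_one]
    conv_lhs => rw [h1]
    rw [← Matrix.mulVec_mulVec, Matrix.dotProduct_mulVec, ← Matrix.star_mulVec, dotProduct,
      Complex.re_sum]
    rfl
  have hS : ∀ v, S *ᵥ (T *ᵥ v) = v := fun v => by
    rw [Matrix.mulVec_mulVec, hST, Matrix.one_mulVec]
  have hself : ∀ (c : ℝ) (z : ℂ), (star z * -((c : ℂ) * z)).re = -(c * ‖z‖ ^ 2) := fun c z => by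
    rw [mul_neg, mul_left_comm, Complex.neg_re, Complex.re_ofReal_mul, Complex.star_def,
      ← Complex.normSq_eq_conj_mul_self, Complex.ofReal_re, Complex.normSq_eq_norm_sq]
  have hnorm : ∀ (c : ℝ) (z : ℂ), ‖-((c : ℂ) * z)‖ ^ 2 = c ^ 2 * ‖z‖ ^ 2 := fun c z => by
    rw [norm_neg, norm_mul, Complex.norm_real, mul_pow, Real.norm_eq_abs, sq_abs]
  -- The test vector has Sy = -D⁻¹Zx, the minimizer of the block form in y.
  have hZA : ∀ x, ∑ i, (d i)⁻¹ * ‖(Z *ᵥ x) i‖ ^ 2 ≤ (star x ⬝ᵥ (A *ᵥ x)).re := fun x => by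
    have h1 := h.1.block_nonneg x (T *ᵥ fun i => -(((d i)⁻¹ : ℝ) * (Z *ᵥ x) i))
    rw [hX, hb, hS] at h1
    simp only [hself, hnorm] at h1
    have h2 : ∀ i, d i * ((d i)⁻¹ ^ 2 * ‖(Z *ᵥ x) i‖ ^ 2) = (d i)⁻¹ * ‖(Z *ᵥ x) i‖ ^ 2 :=
      fun i => by have := (hd i).ne'; field_simp
    simp only [h2, Finset.sum_neg_distrib] at h1
    linarith
  -- For the partial transpose the quadratic term in y is ‖Sy‖², minimized at Sy = -Zx. The weight
  -- `(d i)⁻¹ * d i` is 1, written to match e = d⁻¹, r = d.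
  have hZB : ∀ x, ∑ i, (d i)⁻¹ * d i * ‖(Z *ᵥ x) i‖ ^ 2 ≤ (star x ⬝ᵥ (B *ᵥ x)).re := fun x => by
    have h1 := h.block_nonneg_swap x (T *ᵥ fun i => -(((1 : ℝ) : ℂ) * (Z *ᵥ x) i))
    rw [hX, ha, hS] at h1
    simp only [hself, hnorm, Finset.sum_neg_distrib, one_mul, one_pow] at h1
    simp only [inv_mul_cancel₀ (hd _).ne', one_mul]
    linarith
  have ht' : 1 - t ∈ Set.Icc (0 : ℝ) 1 := ⟨by linarith [ht.2], by linarith [ht.1]⟩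
  have hx := sum_le_re_geomMean hA hB ht Z (fun i => inv_pos.2 (hd i)) hd hZA hZB x
  have hy := sum_le_re_geomMean hA hB ht' S (fun _ => one_pos) hd
    (fun x => by simp only [one_mul]; exact (ha x).ge)
    (fun x => by simp only [one_mul]; exact (hb x).ge) y
  have hsum := Finset.sum_le_sum fun i (_ : i ∈ Finset.univ) =>
    neg_two_mul_re_star_mul_le (hd i) t ((Z *ᵥ x) i) ((S *ᵥ y) i)
  rw [Finset.sum_neg_distrib, ← Finset.mul_sum, ← hX, Finset.sum_add_distrib] at hsum
  simp only [one_mul] at hy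
  linarith

end BlockMatrices

/-! ### Singular values, pinching and norm comparison. -/

section UnitarilyInvariantNorms

variable {m : Type*} [Fintype m] [DecidableEq m]

theorem mem_unitaryGroup_of_orthonormalBasis (b : OrthonormalBasis m ℂ (EuclideanSpace ℂ m)) :
    (Matrix.of fun i j => b j i) ∈ Matrix.unitaryGroup m ℂ := by
  rw [Matrix.mem_unitaryGroup_iff']
  ext i j
  have := orthonormal_iff_ite.1 b.orthonormal i j
  rw [EuclideanSpace.inner_eq_star_dotProduct, dotProduct] at this
  rw [Matrix.mul_apply, Matrix.one_apply, ← this]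
  exact Finset.sum_congr rfl fun k _ => mul_comm _ _

/-- Singular value decomposition. -/
theorem exists_unitary_mul_mul_eq_diagonal (X : Matrix m m ℂ) :
    ∃ U ∈ Matrix.unitaryGroup m ℂ, ∃ V ∈ Matrix.unitaryGroup m ℂ, ∃ σ : m → ℝ, (∀ i, 0 ≤ σ i) ∧
      Uᴴ * X * V = Matrix.diagonal (fun i => (σ i : ℂ)) := by
  have hH := Matrix.isHermitian_conjTranspose_mul_self X
  set v := hH.eigenvectorBasis with hv
  let w : m → EuclideanSpace ℂ m := fun i => WithLp.toLp 2 (X *ᵥ v i)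
  have hw : ∀ i j, inner ℂ (w i) (w j) = if i = j then (hH.eigenvalues j : ℂ) else 0 := by
    intro i j
    have h1 := orthonormal_iff_ite.1 v.orthonormal i j
    rw [EuclideanSpace.inner_eq_star_dotProduct] at h1
    rw [EuclideanSpace.inner_toLp_toLp, dotProduct_comm, Matrix.star_mulVec,
      ← Matrix.dotProduct_mulVec, Matrix.mulVec_mulVec, hH.mulVec_eigenvectorBasis,
      dotProduct_smul, dotProduct_comm, h1]
    split_ifs <;> simp
  let s : Set m := {i | w i ≠ 0}
  let e : m → EuclideanSpace ℂ m := fun i => ((‖w i‖⁻¹ : ℝ) : ℂ) • w i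
  -- The images X vᵢ of the eigenvectors of X*X are mutually orthogonal. The nonzero ones are
  -- normalized and then completed to a basis of left singular vectors.
  have he : Orthonormal ℂ (s.domRestrict e) := by
    refine ⟨fun i => ?_, fun i j hij => ?_⟩
    · have : ‖w i‖ ≠ 0 := norm_ne_zero_iff.2 i.2
      change ‖((‖w i‖⁻¹ : ℝ) : ℂ) • w i‖ = 1
      rw [norm_smul, Complex.norm_real, norm_inv, norm_norm, inv_mul_cancel₀ this]
    · change inner ℂ (((‖w i‖⁻¹ : ℝ) : ℂ) • w i) (((‖w j‖⁻¹ : ℝ) : ℂ) • w j) = 0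
      rw [inner_smul_left, inner_smul_right, hw, if_neg fun h => hij (Subtype.ext h)]
      simp
  obtain ⟨b, hb⟩ := he.exists_orthonormalBasis_extension_of_card_eq finrank_euclideanSpace
  have hwb : ∀ i, w i = (‖w i‖ : ℂ) • b i := by
    intro i
    by_cases hi : w i = 0
    · simp [hi]
    · rw [hb i hi]
      change w i = (‖w i‖ : ℂ) • ((‖w i‖⁻¹ : ℝ) : ℂ) • w i
      rw [smul_smul, ← Complex.ofReal_mul, mul_inv_cancel₀ (norm_ne_zero_iff.2 hi),
        Complex.ofReal_one, one_smul]
  refine ⟨_, mem_unitaryGroup_of_orthonormalBasis b, _, mem_unitaryGroup_of_orthonormalBasis v,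
    fun i => ‖w i‖, fun i => norm_nonneg _, ?_⟩
  have hXV : X * (Matrix.of fun i j => v j i) =
      (Matrix.of fun i j => b j i) * Matrix.diagonal (fun i => (‖w i‖ : ℂ)) := by
    ext i j
    have h1 : (X * (Matrix.of fun i j => v j i)) i j = w j i := rfl
    rw [h1, Matrix.mul_diagonal, Matrix.of_apply, mul_comm]
    exact congrArg (fun u : EuclideanSpace ℂ m => u i) (hwb j)
  have hU := Matrix.mem_unitaryGroup_iff'.1 (mem_unitaryGroup_of_orthonormalBasis b)
  rw [mul_assoc, hXV, ← mul_assoc, ← Matrix.star_eq_conjTranspose, hU, one_mul]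

theorem diagonal_mem_unitaryGroup {u : m → ℂ} (hu : ∀ i, ‖u i‖ = 1) :
    Matrix.diagonal u ∈ Matrix.unitaryGroup m ℂ := by
  rw [Matrix.mem_unitaryGroup_iff, Matrix.star_eq_conjTranspose, Matrix.diagonal_conjTranspose,
    Matrix.diagonal_mul_diagonal, ← Matrix.diagonal_one]
  congr 1
  funext i
  rw [Pi.star_apply, Complex.star_def, Complex.mul_conj, Complex.normSq_eq_norm_sq, hu]
  simp

/-- Rotate the direction of `c` by ±θ with cos θ = ‖c‖; the mean of the two unit numbers is `c`. -/
theorem exists_add_eq_two_mul_of_norm_le_one {c : ℂ} (hc : ‖c‖ ≤ 1) :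
    ∃ u v : ℂ, ‖u‖ = 1 ∧ ‖v‖ = 1 ∧ u + v = 2 * c := by
  set θ := Real.arccos ‖c‖
  have hθ : Real.cos θ = ‖c‖ := Real.cos_arccos (by linarith [norm_nonneg c]) hc
  refine ⟨Complex.exp (((c.arg + θ : ℝ) : ℂ) * Complex.I),
    Complex.exp (((c.arg - θ : ℝ) : ℂ) * Complex.I), Complex.norm_exp_ofReal_mul_I _,
    Complex.norm_exp_ofReal_mul_I _, ?_⟩
  conv_rhs => rw [← Complex.norm_mul_exp_arg_mul_I c, ← hθ]
  rw [Complex.ofReal_cos, Complex.cos]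
  push_cast
  rw [add_mul, sub_mul, Complex.exp_add, Complex.exp_sub, neg_mul, Complex.exp_neg]
  ring

variable {N : Seminorm ℂ (Matrix m m ℂ)} (hN : IsUnitarilyInvariantNorm N)
include hN

/-- A diagonal contraction is the average of two diagonal unitaries. -/
theorem IsUnitarilyInvariantNorm.diagonal_mul_le {c l : m → ℂ} (hc : ∀ i, ‖c i‖ ≤ 1) :
    N (Matrix.diagonal fun i => c i * l i) ≤ N (Matrix.diagonal l) := by
  choose u v hu hv huv using fun i => exists_add_eq_two_mul_of_norm_le_one (hc i)
  have h1 : (Matrix.diagonal fun i => c i * l i) =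
      (1 / 2 : ℂ) • (Matrix.diagonal u * Matrix.diagonal l * 1 +
        Matrix.diagonal v * Matrix.diagonal l * 1) := by
    rw [mul_one, mul_one, Matrix.diagonal_mul_diagonal, Matrix.diagonal_mul_diagonal,
      Matrix.diagonal_add, ← Matrix.diagonal_smul]
    congr 1
    funext i
    rw [Pi.smul_apply, smul_eq_mul, ← add_mul, huv]
    ring
  rw [h1, map_smul_eq_mul]
  have h2 := map_add_le_add N (Matrix.diagonal u * Matrix.diagonal l * 1)
    (Matrix.diagonal v * Matrix.diagonal l * 1)
  rw [hN.2 _ _ (diagonal_mem_unitaryGroup hu) _ (one_mem _),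
    hN.2 _ _ (diagonal_mem_unitaryGroup hv) _ (one_mem _)] at h2
  have h3 : ‖(1 / 2 : ℂ)‖ = 1 / 2 := by norm_num
  rw [h3]
  linarith

/-- Pinching: the diagonal part does not increase a unitarily invariant norm. -/
theorem IsUnitarilyInvariantNorm.diagonal_diag_le (L : Matrix m m ℂ) :
    N (Matrix.diagonal L.diag) ≤ N L := by
  let D : (m → ℤˣ) → Matrix m m ℂ := fun ε => Matrix.diagonal fun i => ((ε i : ℤ) : ℂ)
  have hD : ∀ ε, D ε ∈ Matrix.unitaryGroup m ℂ := fun ε => diagonal_mem_unitaryGroup fun i => by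
    rcases Int.units_eq_one_or (ε i) with h | h <;> simp [h]
  -- Averaging over all sign conjugations keeps the diagonal and cancels every other entry.
  have hsum : ∑ ε, D ε * L * D ε = (Fintype.card (m → ℤˣ) : ℂ) • Matrix.diagonal L.diag := by
    ext i j
    have h1 : ∀ ε, (D ε * L * D ε) i j = ((ε i : ℤ) : ℂ) * ((ε j : ℤ) : ℂ) * L i j := fun ε => by
      rw [Matrix.mul_diagonal, Matrix.diagonal_mul]; ring
    rw [Matrix.sum_apply]
    simp only [h1]
    rw [← Finset.sum_mul, Matrix.smul_apply, smul_eq_mul]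
    by_cases hij : i = j
    · subst hij
      rw [Matrix.diagonal_apply_eq, Matrix.diag_apply]
      congr 1
      have h2 : ∀ ε : m → ℤˣ, ((ε i : ℤ) : ℂ) * ((ε i : ℤ) : ℂ) = 1 := fun ε => by
        rcases Int.units_eq_one_or (ε i) with h | h <;> simp [h]
      simp only [h2, Finset.sum_const, Finset.card_univ, nsmul_eq_mul, mul_one]
    · rw [Matrix.diagonal_apply_ne _ hij, mul_zero]
      -- Flipping the sign of coordinate `i` permutes the sign vectors and negates the summand, so
      -- the sum vanishes.
      have h3 := Equiv.sum_comp (Equiv.mulRight (Pi.mulSingle i (-1 : ℤˣ)))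
        (fun ε : m → ℤˣ => ((ε i : ℤ) : ℂ) * ((ε j : ℤ) : ℂ))
      simp only [Equiv.coe_mulRight, Pi.mul_apply, Pi.mulSingle_eq_same,
        Pi.mulSingle_eq_of_ne (Ne.symm hij), mul_one, mul_neg, Units.val_neg, Int.cast_neg,
        neg_mul, Finset.sum_neg_distrib] at h3
      rw [neg_eq_self.1 h3, zero_mul]
  have hle : N (∑ ε, D ε * L * D ε) ≤ ∑ ε : m → ℤˣ, N L := by
    refine (Finset.le_sum_of_subadditive N (map_zero N).le (map_add_le_add N) _ _).trans_eq ?_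
    exact Finset.sum_congr rfl fun ε _ => hN.2 _ _ (hD ε) _ (hD ε)
  rw [hsum, map_smul_eq_mul, Finset.sum_const, Finset.card_univ, nsmul_eq_mul,
    Complex.norm_natCast] at hle
  exact le_of_mul_le_mul_left hle (by exact_mod_cast Fintype.card_pos)

/-- Evaluated at a left and a negated right singular vector, the hypothesis bounds 2σᵢ by a diagonal
entry of an average of two unitary conjugates of `S`. That average has norm at most `N S`, and
pinching leaves a comparison of diagonal matrices. -/
theorem IsUnitarilyInvariantNorm.le_half_of_block_nonneg {S X : Matrix m m ℂ}
    (h : ∀ x y, 0 ≤ (star x ⬝ᵥ (S *ᵥ x)).re + 4 * (star x ⬝ᵥ (X *ᵥ y)).re +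
      (star y ⬝ᵥ (S *ᵥ y)).re) : N X ≤ 1 / 2 * N S := by
  obtain ⟨U, hU, V, hV, σ, hσ, hX⟩ := exists_unitary_mul_mul_eq_diagonal X
  have hU' : Uᴴ ∈ Matrix.unitaryGroup m ℂ := Unitary.star_mem hU
  have hV' : Vᴴ ∈ Matrix.unitaryGroup m ℂ := Unitary.star_mem hV
  -- Left and right singular vectors differ, so both conjugates of `S` occur.
  set L := (1 / 2 : ℂ) • (Uᴴ * S * U + Vᴴ * S * V) with hL
  have hLS : N L ≤ N S := by
    rw [hL, map_smul_eq_mul]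
    have h2 := map_add_le_add N (Uᴴ * S * U) (Vᴴ * S * V)
    rw [hN.2 _ _ hU' _ hU, hN.2 _ _ hV' _ hV] at h2
    have h3 : ‖(1 / 2 : ℂ)‖ = 1 / 2 := by norm_num
    rw [h3]
    linarith
  have hentry : ∀ (Y G H : Matrix m m ℂ) (i j : m),
      star (G *ᵥ Pi.single i 1) ⬝ᵥ (Y *ᵥ (H *ᵥ Pi.single j 1)) = (Gᴴ * Y * H) i j := by
    intro Y G H i j
    rw [Matrix.star_mulVec, ← Matrix.dotProduct_mulVec, Matrix.mulVec_mulVec,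
      Matrix.mulVec_mulVec, Matrix.mulVec_single_one]
    simp
  have hdiag : ∀ i, 2 * σ i ≤ ‖L i i‖ := by
    intro i
    have h1 := h (U *ᵥ Pi.single i 1) (-(V *ᵥ Pi.single i 1))
    simp only [Matrix.mulVec_neg, star_neg, neg_dotProduct, dotProduct_neg, neg_neg] at h1
    rw [hentry, hentry, hentry, hX, Matrix.diagonal_apply_eq, Complex.neg_re,
      Complex.ofReal_re] at h1
    have h2 : (L i i).re = 1 / 2 * (((Uᴴ * S * U) i i).re + ((Vᴴ * S * V) i i).re) := by
      have h3 : (1 / 2 : ℂ) = ((1 / 2 : ℝ) : ℂ) := by norm_num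
      rw [hL, Matrix.smul_apply, Matrix.add_apply, smul_eq_mul, h3, Complex.re_ofReal_mul,
        Complex.add_re]
    have h4 := Complex.re_le_norm (L i i)
    linarith
  have hXσ : N X = N (Matrix.diagonal fun i => (σ i : ℂ)) := by
    rw [← hX, hN.2 _ _ hU' _ hV]
  -- If `L i i = 0` then σᵢ = 0, so division by zero giving 0 is harmless here.
  have hσL : (Matrix.diagonal fun i => ((2 * σ i / L i i) * L.diag i : ℂ)) =
      (2 : ℂ) • Matrix.diagonal fun i => (σ i : ℂ) := by
    rw [← Matrix.diagonal_smul]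
    congr 1
    funext i
    rw [Pi.smul_apply, smul_eq_mul, Matrix.diag_apply]
    by_cases h0 : L i i = 0
    · have h1 := hdiag i
      rw [h0, norm_zero] at h1
      have h2 : σ i = 0 := by linarith [hσ i]
      simp [h2]
    · exact div_mul_cancel₀ _ h0
  have h1 := (hN.diagonal_mul_le (c := fun i => 2 * σ i / L i i) (l := L.diag) fun i => by
    rw [norm_div, norm_mul, Complex.norm_real, Real.norm_of_nonneg (hσ i)]
    refine div_le_one_of_le₀ ?_ (norm_nonneg _)
    simpa using hdiag i).trans (hN.diagonal_diag_le L)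
  rw [hσL, map_smul_eq_mul, ← hXσ] at h1
  norm_num at h1
  linarith

end UnitarilyInvariantNorms

end AccretiveMatrix

theorem mainTheorem11 {n : ℕ} (A B X : Matrix (Fin n) (Fin n) ℂ)
    (hA : AccretiveMatrix.IsStrictlyAccretive A) (hB : AccretiveMatrix.IsStrictlyAccretive B)
    (α : ℝ) (hα : α ∈ Set.Ico 0 (Real.pi / 2))
    (hAPT : AccretiveMatrix.IsAPT (Matrix.fromBlocks A X Xᴴ B))
    (hM : AccretiveMatrix.numericalRange (Matrix.fromBlocks A X Xᴴ B) ⊆ AccretiveMatrix.sector α)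
    (N : Seminorm ℂ (Matrix (Fin n) (Fin n) ℂ))
    (hN : AccretiveMatrix.IsUnitarilyInvariantNorm N)
    (t : ℝ) (ht : t ∈ Set.Icc (0 : ℝ) 1) :
    N X ≤ (1 / Real.cos α) / 2 *
      N (AccretiveMatrix.geomMean t A B + AccretiveMatrix.geomMean (1 - t) A B) := by
  have ht' : 1 - t ∈ Set.Icc (0 : ℝ) 1 := ⟨by linarith [ht.2], by linarith [ht.1]⟩
  have hcos : 0 < Real.cos α :=
    Real.cos_pos_of_mem_Ioo ⟨by linarith [hα.1, Real.pi_pos], hα.2⟩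
  have hsec : 1 ≤ 1 / Real.cos α := (one_le_div hcos).2 (Real.cos_le_one α)
  -- The estimate with constant `1 / 2` is weakened by `1 ≤ 1 / Real.cos α`. Its hypothesis is the
  -- sum of the block inequalities for `t` and `1 - t`: each diagonal block becomes the symmetric
  -- sum and the cross term doubles from 2 to 4.
  refine (hN.le_half_of_block_nonneg fun x y => ?_).trans
    (mul_le_mul_of_nonneg_right (by linarith) (apply_nonneg N _))
  have h1 := hAPT.geomMean_block_nonneg hA hB ht x y
  have h2 := hAPT.geomMean_block_nonneg hA hB ht' x y
  rw [sub_sub_cancel] at h2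
  simp only [Matrix.add_mulVec, dotProduct_add, Complex.add_re]
  linarith
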